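/- A factorization $f = pc$, with $c\colon X\to W$ and $p\colon W\to Y$, of a morphism in a category is called minimal if every morphism $\varphi\colon W\to W$ with $\varphi c=c$ and $p\varphi=p$ is an isomorphism. A model category $\mathcal{M}$ (a category with finite limits and colimits and with classes of weak equivalences, fibrations and cofibrations satisfying the usual two-out-of-three, retract, lifting and factorization axioms; factorizations are not required to be functorial) satisfies the minimal cofibrant factorization axiom if every morphism $f$ of $\mathcal{M}$ has a minimal factorization $f=pc$ in which $c$ is a cofibration and $p$ is both a fibration and a weak equivalence. Let $\mathcal{D}$ be a finite poset and $\mathcal{C}$ a model category. For $x\in\mathcal{D}$ let $\mathcal{D}<x$ denote the subposet of elements strictly smaller than $x$. Then the following choices of weak equivalences, fibrations and cofibrations in the functor category $\mathrm{Fun}(\mathcal{D},\mathcal{C})$ form a model structure. A morphism $\varphi\colon X\to Y$ is - a weak equivalence (respectively, a fibration) if, for every $x\in\mathcal{D}$, the morphism $\varphi(x)\colon X(x)\to Y(x)$ is a weak equivalence (respectively, a fibration) in $\mathcal{C}$; - a cofibration if, for every $x\in\mathcal{D}$, the mediating morphism $$\widehat{\varphi}(x)\colon \operatorname{colim}\Bigl(\operatorname{colim}_{\mathcal{D}<x}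 Y \xleftarrow{\ \operatorname{colim}_{\mathcal{D}<x}\varphi\ } \operatorname{colim}_{\mathcal{D}<x} X \to X(x)\Bigr)\to Y(x)$$ induced by $\operatorname{colim}_{\mathcal{D}<x}Y\to Y(x)$ and $\varphi(x)$ is a cofibration in $\mathcal{C}$. Furthermore, if $\mathcal{C}$ satisfies the minimal cofibrant factorization axiom, then so does $\mathrm{Fun}(\mathcal{D},\mathcal{C})$ with this model structure. -/

import Mathlib

open CategoryTheory CategoryTheory.Limits HomotopicalAlgebra

universe w v u

namespace FinitePosetModel

section Minimality

variable {C : Type u} [Category.{v} C]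

/-- A factorization of `c ≫ p` through `W` is minimal if every endomorphism of `W` which is
compatible with both `c` and `p` is an isomorphism. -/
def IsMinimalFactorization {X W Y : C} (c : X ⟶ W) (p : W ⟶ Y) : Prop :=
  ∀ φ : W ⟶ W, c ≫ φ = c → φ ≫ p = p → IsIso φ

/-- The minimal cofibrant factorization axiom: every morphism `f` of the model category `C`
factors as a cofibration `c` followed by a fibration `p` which is also a weak equivalence,
in such a way that this factorization is minimal. -/
def MinimalCofibrantFactorizationAxiom (C : Type u) [Category.{v} C] [ModelCategory C] : Prop :=
  ∀ ⦃X Y : C⦄ (f : X ⟶ Y), ∃ (W : C) (c : X ⟶ W) (p : W ⟶ Y),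
    c ≫ p = f ∧ Cofibration c ∧ Fibration p ∧ WeakEquivalence p ∧ IsMinimalFactorization c p

end Minimality

section Latching

variable {D : Type w} [PartialOrder D]

/-- The inclusion of the subposet `D < x` of elements strictly below `x`. -/
abbrev strictlyBelow (x : D) : Set.Iio x ⥤ D :=
  (Subtype.mono_coe (· ∈ Set.Iio x)).functor

variable {C : Type u} [Category.{v} C] [HasFiniteColimits C] [Finite D]

instance hasColimitsOfShape_strictlyBelow (x : D) : HasColimitsOfShape (Set.Iio x) C := by
  have : Fintype (Set.Iio x) := Fintype.ofFinite _
  infer_instance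

/-- The latching object `colim_{D < x} X`. -/
noncomputable def latchingObj (X : D ⥤ C) (x : D) : C :=
  colimit (strictlyBelow x ⋙ X)

/-- The structure morphism `X(y) ⟶ colim_{D < x} X` of the colimit, for `y < x`. -/
noncomputable def latchingι (X : D ⥤ C) {x y : D} (h : y < x) : X.obj y ⟶ latchingObj X x :=
  colimit.ι (strictlyBelow x ⋙ X) ⟨y, h⟩

lemma latchingObj_hom_ext {X : D ⥤ C} {x : D} {Z : C} {f g : latchingObj X x ⟶ Z}
    (h : ∀ (y : D) (hy : y < x), latchingι X hy ≫ f = latchingι X hy ≫ g) : f = g :=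
  colimit.hom_ext (F := strictlyBelow x ⋙ X) (fun y => h y.1 y.2)

/-- The cocone under the restriction of `X` to `D < x` with point `X(x)`, given at `y < x` by
the structure morphism `X(y) ⟶ X(x)`. -/
def latchingCocone (X : D ⥤ C) (x : D) : Cocone (strictlyBelow x ⋙ X) where
  pt := X.obj x
  ι :=
    { app := fun y => X.map (show (strictlyBelow x).obj y ⟶ x from
        homOfLE (le_of_lt (Set.mem_Iio.mp y.2)))
      naturality := fun y z g => by
        refine (X.map_comp _ _).symm.trans (Eq.trans ?_ (Category.comp_id _).symm)
        exact congrArg X.map (Subsingleton.elim _ _) }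

/-- The canonical morphism `colim_{D < x} X ⟶ X(x)`. -/
noncomputable def latchingMap (X : D ⥤ C) (x : D) : latchingObj X x ⟶ X.obj x :=
  colimit.desc (strictlyBelow x ⋙ X) (latchingCocone X x)

lemma latchingι_latchingMap (X : D ⥤ C) {x y : D} (h : y < x) :
    latchingι X h ≫ latchingMap X x = X.map (homOfLE h.le) :=
  colimit.ι_desc (latchingCocone X x) _

/-- The morphism `colim_{D < x} φ : colim_{D < x} X ⟶ colim_{D < x} Y`. -/
noncomputable def latchingObjMap {X Y : D ⥤ C} (φ : X ⟶ Y) (x : D) :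
    latchingObj X x ⟶ latchingObj Y x :=
  colimMap (Functor.whiskerLeft (strictlyBelow x) φ)

lemma latchingι_latchingObjMap {X Y : D ⥤ C} (φ : X ⟶ Y) {x y : D} (h : y < x) :
    latchingι X h ≫ latchingObjMap φ x = φ.app y ≫ latchingι Y h :=
  ι_colimMap (Functor.whiskerLeft (strictlyBelow x) φ) _

lemma latchingObjMap_comp_latchingMap {X Y : D ⥤ C} (φ : X ⟶ Y) (x : D) :
    latchingObjMap φ x ≫ latchingMap Y x = latchingMap X x ≫ φ.app x := by
  refine latchingObj_hom_ext (fun y hy => ?_)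
  rw [← Category.assoc, latchingι_latchingObjMap, Category.assoc, latchingι_latchingMap,
    ← Category.assoc, latchingι_latchingMap, φ.naturality]

/-- The mediating morphism from the pushout of
`colim_{D < x} Y ⟵ colim_{D < x} X ⟶ X(x)` to `Y(x)`. -/
noncomputable def relativeLatchingMap {X Y : D ⥤ C} (φ : X ⟶ Y) (x : D) :
    pushout (latchingObjMap φ x) (latchingMap X x) ⟶ Y.obj x :=
  pushout.desc (latchingMap Y x) (φ.app x) (latchingObjMap_comp_latchingMap φ x)

end Latching

section ProjectiveClasses

variable (D : Type w) [PartialOrder D] [Finite D] (C : Type u) [Category.{v} C] [ModelCategory C]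

/-- The natural transformations that are objectwise weak equivalences. -/
def objectwiseWeakEquivalences : MorphismProperty (D ⥤ C) :=
  fun _ _ φ => ∀ x : D, WeakEquivalence (φ.app x)

/-- The natural transformations that are objectwise fibrations. -/
def objectwiseFibrations : MorphismProperty (D ⥤ C) :=
  fun _ _ φ => ∀ x : D, Fibration (φ.app x)

/-- The natural transformations all of whose mediating morphisms are cofibrations. -/
def latchingCofibrations : MorphismProperty (D ⥤ C) :=
  fun _ _ φ => ∀ x : D, Cofibration (relativeLatchingMap φ x)

end ProjectiveClasses

end FinitePosetModel

namespace FinitePosetModel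

section FinitePoset

/-- Induction on lower sets of a finite poset, adding one element at a time. -/
theorem lowerSet_induction {ι : Type*} [PartialOrder ι] [Finite ι] {P : Set ι → Prop}
    (empty : P ∅)
    (insert : ∀ (S : Set ι) (m : ι), IsLowerSet S → m ∉ S → (∀ y < m, y ∈ S) → P S →
      P (insert m S)) : P Set.univ := by
  obtain ⟨S, ⟨hS, hPS⟩, hmax⟩ := (wellFounded_gt (α := Set ι)).has_min
    {S | IsLowerSet S ∧ P S} ⟨∅, isLowerSet_empty, empty⟩
  by_cases hu : S = Set.univ
  · exact hu ▸ hPS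
  obtain ⟨m, hm, hmin⟩ := (wellFounded_lt (α := ι)).has_min Sᶜ
    (Set.nonempty_compl.mpr hu)
  have hlt : ∀ y < m, y ∈ S := fun y hy => by
    by_contra h
    exact hmin y h hy
  refine absurd (Set.ssubset_insert hm) (hmax _ ⟨?_, insert S m hS hm hlt hPS⟩)
  rintro x y hyx (rfl | hx)
  · rcases hyx.eq_or_lt with rfl | h
    · exact Or.inl rfl
    · exact Or.inr (hlt _ h)
  · exact Or.inr (hS hyx hx)

/-- Coherent families over a finite poset may be chosen one element at a time. -/
theorem exists_coherent_family {ι : Type*} [PartialOrder ι] [Finite ι] (α : ι → Type*)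
    (R : ∀ ⦃y x : ι⦄, y < x → α y → α x → Prop)
    (ext : ∀ (x : ι) (a : ∀ y, y < x → α y),
      (∀ (z y : ι) (hzy : z < y) (hy : y < x), R hzy (a z (hzy.trans hy)) (a y hy)) →
      ∃ b : α x, ∀ (y : ι) (hy : y < x), R hy (a y hy) b) :
    ∃ a : ∀ x, α x, ∀ (y x : ι) (h : y < x), R h (a y) (a x) := by
  classical
  suffices h : ∃ a : ∀ x, x ∈ (Set.univ : Set ι) → α x,
      ∀ (y x : ι) (hy : y ∈ Set.univ) (hx : x ∈ Set.univ) (h : y < x),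
        R h (a y hy) (a x hx) by
    obtain ⟨a, ha⟩ := h
    exact ⟨fun x => a x trivial, fun y x h => ha y x _ _ h⟩
  refine lowerSet_induction (P := fun S => ∃ a : ∀ x, x ∈ S → α x,
      ∀ (y x : ι) (hy : y ∈ S) (hx : x ∈ S) (h : y < x), R h (a y hy) (a x hx))
    ⟨fun x hx => hx.elim, fun y x hy => hy.elim⟩ ?_
  rintro S m hS hm hlt ⟨a, ha⟩
  obtain ⟨b, hb⟩ := ext m (fun y hy => a y (hlt y hy)) (fun z y hzy hy => ha _ _ _ _ _)
  refine ⟨fun x hx => if h : x = m then h ▸ b else a x (hx.resolve_left h), ?_⟩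
  intro y x hy hx h
  by_cases hxm : x = m
  · subst hxm
    simpa [h.ne] using hb y h
  · by_cases hym : y = m
    · subst hym
      exact absurd (hS h.le (hx.resolve_left hxm)) hm
    · simpa [hxm, hym] using ha y x _ _ h

end FinitePoset

section LatchingFunctoriality

variable {D : Type w} [PartialOrder D] {C : Type u} [Category.{v} C] [HasFiniteColimits C]
  [Finite D]

/-- The morphism out of a latching object given by a compatible family. -/
noncomputable def latchingDesc {X : D ⥤ C} {x : D} {Z : C} (l : ∀ y, y < x → (X.obj y ⟶ Z))
    (hl : ∀ (z y : D) (hzy : z < y) (hy : y < x),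
      X.map (homOfLE hzy.le) ≫ l y hy = l z (hzy.trans hy)) : latchingObj X x ⟶ Z :=
  colimit.desc (strictlyBelow x ⋙ X)
    { pt := Z
      ι :=
        { app := fun y => l y.1 y.2
          naturality := fun z y g => by
            refine Eq.trans ?_ (Category.comp_id _).symm
            rcases (leOfHom g).eq_or_lt with h | h
            · subst h
              obtain rfl : g = 𝟙 _ := Subsingleton.elim _ _
              simp
            · exact hl z.1 y.1 h y.2 } }

@[simp]
lemma latchingι_latchingDesc {X : D ⥤ C} {x : D} {Z : C} (l : ∀ y, y < x → (X.obj y ⟶ Z))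
    (hl : ∀ (z y : D) (hzy : z < y) (hy : y < x),
      X.map (homOfLE hzy.le) ≫ l y hy = l z (hzy.trans hy)) {y : D} (hy : y < x) :
    latchingι X hy ≫ latchingDesc l hl = l y hy :=
  colimit.ι_desc _ _

lemma map_latchingι (X : D ⥤ C) {x y z : D} (hzy : z < y) (hy : y < x) :
    X.map (homOfLE hzy.le) ≫ latchingι X hy = latchingι X (hzy.trans hy) :=
  colimit.w (strictlyBelow x ⋙ X)
    (homOfLE (show (⟨z, hzy.trans hy⟩ : Set.Iio x) ≤ ⟨y, hy⟩ from hzy.le))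

lemma latchingObjMap_id (X : D ⥤ C) (x : D) : latchingObjMap (𝟙 X) x = 𝟙 _ :=
  latchingObj_hom_ext fun y hy => by simp [latchingι_latchingObjMap]

lemma latchingObjMap_comp {X Y Z : D ⥤ C} (f : X ⟶ Y) (g : Y ⟶ Z) (x : D) :
    latchingObjMap f x ≫ latchingObjMap g x = latchingObjMap (f ≫ g) x :=
  latchingObj_hom_ext fun y hy => by
    simp [latchingι_latchingObjMap, reassoc_of% @latchingι_latchingObjMap]

lemma isIso_latchingObjMap {X Y : D ⥤ C} (f : X ⟶ Y) (x : D)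
    (hf : ∀ y < x, IsIso (f.app y)) : IsIso (latchingObjMap f x) := by
  have : IsIso (Functor.whiskerLeft (strictlyBelow x) f) := by
    rw [NatTrans.isIso_iff_isIso_app]
    exact fun y => hf y.1 y.2
  exact inferInstanceAs (IsIso (colim.map (Functor.whiskerLeft (strictlyBelow x) f)))

@[simp]
lemma inl_relativeLatchingMap {X Y : D ⥤ C} (φ : X ⟶ Y) (x : D) :
    pushout.inl _ _ ≫ relativeLatchingMap φ x = latchingMap Y x :=
  pushout.inl_desc _ _ _

@[simp]
lemma inr_relativeLatchingMap {X Y : D ⥤ C} (φ : X ⟶ Y) (x : D) :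
    pushout.inr _ _ ≫ relativeLatchingMap φ x = φ.app x :=
  pushout.inr_desc _ _ _

/-- The source of the mediating morphism. -/
noncomputable abbrev relativeLatchingObj {X Y : D ⥤ C} (φ : X ⟶ Y) (x : D) : C :=
  pushout (latchingObjMap φ x) (latchingMap X x)

/-- The functoriality of the source of the mediating morphism. -/
noncomputable def relativeLatchingObjMap {X Y X' Y' : D ⥤ C} {φ : X ⟶ Y} {φ' : X' ⟶ Y'}
    (a : X ⟶ X') (b : Y ⟶ Y') (h : φ ≫ b = a ≫ φ') (x : D) :
    relativeLatchingObj φ x ⟶ relativeLatchingObj φ' x :=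
  pushout.map _ _ _ _ (latchingObjMap b x) (a.app x) (latchingObjMap a x)
    (by rw [latchingObjMap_comp, latchingObjMap_comp, h])
    (latchingObjMap_comp_latchingMap a x).symm

@[simp]
lemma inl_relativeLatchingObjMap {X Y X' Y' : D ⥤ C} {φ : X ⟶ Y} {φ' : X' ⟶ Y'}
    (a : X ⟶ X') (b : Y ⟶ Y') (h : φ ≫ b = a ≫ φ') (x : D) :
    pushout.inl _ _ ≫ relativeLatchingObjMap a b h x = latchingObjMap b x ≫ pushout.inl _ _ :=
  pushout.inl_desc _ _ _

@[simp]
lemma inr_relativeLatchingObjMap {X Y X' Y' : D ⥤ C} {φ : X ⟶ Y} {φ' : X' ⟶ Y'}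
    (a : X ⟶ X') (b : Y ⟶ Y') (h : φ ≫ b = a ≫ φ') (x : D) :
    pushout.inr _ _ ≫ relativeLatchingObjMap a b h x = a.app x ≫ pushout.inr _ _ :=
  pushout.inr_desc _ _ _

lemma relativeLatchingObjMap_relativeLatchingMap {X Y X' Y' : D ⥤ C} {φ : X ⟶ Y} {φ' : X' ⟶ Y'}
    (a : X ⟶ X') (b : Y ⟶ Y') (h : φ ≫ b = a ≫ φ') (x : D) :
    relativeLatchingObjMap a b h x ≫ relativeLatchingMap φ' x =
      relativeLatchingMap φ x ≫ b.app x := by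
  apply pushout.hom_ext
  · simp [latchingObjMap_comp_latchingMap, reassoc_of% @inl_relativeLatchingObjMap,
      reassoc_of% @inl_relativeLatchingMap]
  · simpa [reassoc_of% @inr_relativeLatchingObjMap, reassoc_of% @inr_relativeLatchingMap]
      using (NatTrans.congr_app h x).symm

lemma relativeLatchingObjMap_comp {X Y X' Y' X'' Y'' : D ⥤ C} {φ : X ⟶ Y} {φ' : X' ⟶ Y'}
    {φ'' : X'' ⟶ Y''} (a : X ⟶ X') (b : Y ⟶ Y') (h : φ ≫ b = a ≫ φ')
    (a' : X' ⟶ X'') (b' : Y' ⟶ Y'') (h' : φ' ≫ b' = a' ≫ φ'') (x : D) :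
    relativeLatchingObjMap a b h x ≫ relativeLatchingObjMap a' b' h' x =
      relativeLatchingObjMap (φ := φ) (φ' := φ'') (a ≫ a') (b ≫ b')
        (by rw [reassoc_of% h, h', Category.assoc]) x := by
  apply pushout.hom_ext
  · simp [reassoc_of% @latchingObjMap_comp, reassoc_of% @inl_relativeLatchingObjMap]
  · simp [reassoc_of% @inr_relativeLatchingObjMap]

lemma relativeLatchingObjMap_id {X Y : D ⥤ C} (φ : X ⟶ Y) (x : D) {a : X ⟶ X} {b : Y ⟶ Y}
    (ha : a = 𝟙 X) (hb : b = 𝟙 Y) (h : φ ≫ b = a ≫ φ) :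
    relativeLatchingObjMap a b h x = 𝟙 _ := by
  subst ha hb
  apply pushout.hom_ext
  · simp [latchingObjMap_id]
  · simp

lemma isIso_relativeLatchingObjMap {X Y X' Y' : D ⥤ C} {φ : X ⟶ Y} {φ' : X' ⟶ Y'}
    (a : X ⟶ X') (b : Y ⟶ Y') (h : φ ≫ b = a ≫ φ') (x : D)
    (ha : ∀ y ≤ x, IsIso (a.app y)) (hb : ∀ y < x, IsIso (b.app y)) :
    IsIso (relativeLatchingObjMap a b h x) := by
  have := isIso_latchingObjMap a x fun y hy => ha y hy.le
  have := isIso_latchingObjMap b x hb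
  have := ha x le_rfl
  exact pushout.map_isIso _ _ _ _ (latchingObjMap b x) (a.app x) (latchingObjMap a x)
    (by rw [latchingObjMap_comp, latchingObjMap_comp, h])
    (latchingObjMap_comp_latchingMap a x).symm

/-- The mediating morphism of a retract is a retract of the mediating morphism. -/
noncomputable def retractArrowRelativeLatchingMap {X Y X' Y' : D ⥤ C} {φ : X ⟶ Y} {φ' : X' ⟶ Y'}
    (h : RetractArrow φ φ') (x : D) :
    RetractArrow (relativeLatchingMap φ x) (relativeLatchingMap φ' x) where
  i := Arrow.homMk (relativeLatchingObjMap (φ := φ) (φ' := φ') h.i.left h.i.right h.i.w.symm x)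
    (h.i.right.app x) (relativeLatchingObjMap_relativeLatchingMap _ _ _ _)
  r := Arrow.homMk (relativeLatchingObjMap (φ := φ') (φ' := φ) h.r.left h.r.right h.r.w.symm x)
    (h.r.right.app x) (relativeLatchingObjMap_relativeLatchingMap _ _ _ _)
  retract := by
    ext
    · refine (relativeLatchingObjMap_comp (φ := φ) (φ' := φ') (φ'' := φ) h.i.left h.i.right
        h.i.w.symm h.r.left h.r.right h.r.w.symm x).trans ?_
      exact relativeLatchingObjMap_id _ _ h.retract_left h.retract_right _
    · exact NatTrans.congr_app h.retract_right x

end LatchingFunctoriality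

section Lifting

variable {D : Type w} [PartialOrder D] {C : Type u} [Category.{v} C] [HasFiniteColimits C]
  [Finite D]

/-- Lifts against `p` over a lower set exist if the mediating morphisms lift against `p`. -/
theorem exists_lift_on_lowerSet {S : Set D} (hS : IsLowerSet S) {A B X Y : D ⥤ C}
    (i : A ⟶ B) (p : X ⟶ Y) (f : ∀ y ∈ S, A.obj y ⟶ X.obj y) (g : ∀ y ∈ S, B.obj y ⟶ Y.obj y)
    (hf : ∀ (y x : D) (hy : y ∈ S) (hx : x ∈ S) (h : y ≤ x),
      A.map (homOfLE h) ≫ f x hx = f y hy ≫ X.map (homOfLE h))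
    (hg : ∀ (y x : D) (hy : y ∈ S) (hx : x ∈ S) (h : y ≤ x),
      B.map (homOfLE h) ≫ g x hx = g y hy ≫ Y.map (homOfLE h))
    (w : ∀ y (hy : y ∈ S), f y hy ≫ p.app y = i.app y ≫ g y hy)
    (hlift : ∀ x ∈ S, HasLiftingProperty (relativeLatchingMap i x) (p.app x)) :
    ∃ l : ∀ y ∈ S, B.obj y ⟶ X.obj y,
      (∀ y (hy : y ∈ S), i.app y ≫ l y hy = f y hy ∧ l y hy ≫ p.app y = g y hy) ∧
      ∀ (y x : D) (hy : y ∈ S) (hx : x ∈ S) (h : y ≤ x),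
        B.map (homOfLE h) ≫ l x hx = l y hy ≫ X.map (homOfLE h) := by
  obtain ⟨a, ha⟩ := exists_coherent_family (ι := S)
    (fun y => { l : B.obj y.1 ⟶ X.obj y.1 // i.app y.1 ≫ l = f y.1 y.2 ∧
      l ≫ p.app y.1 = g y.1 y.2 })
    (fun y x h ly lx => B.map (homOfLE (Subtype.coe_le_coe.mpr h.le)) ≫ lx.1 =
      ly.1 ≫ X.map (homOfLE (Subtype.coe_le_coe.mpr h.le))) (by
    rintro ⟨x, hx⟩ a ha
    have hmem : ∀ {y}, y < x → y ∈ S := fun h => hS h.le hx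
    let d : latchingObj B x ⟶ X.obj x := latchingDesc
      (fun y hy => (a ⟨y, hmem hy⟩ hy).1 ≫ X.map (homOfLE hy.le)) (fun z y hzy hy => by
        have := ha ⟨z, hmem (hzy.trans hy)⟩ ⟨y, hmem hy⟩ hzy hy
        dsimp at this
        rw [reassoc_of% this, ← X.map_comp]
        rfl)
    let t : relativeLatchingObj i x ⟶ X.obj x := pushout.desc d (f x hx)
      (latchingObj_hom_ext fun y hy => by
        have h1 := (a ⟨y, hmem hy⟩ hy).2.1
        dsimp at h1
        rw [reassoc_of% @latchingι_latchingObjMap, reassoc_of% @latchingι_latchingMap,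
          latchingι_latchingDesc, reassoc_of% h1, hf _ _ (hmem hy)])
    have sq : CommSq t (relativeLatchingMap i x) (p.app x) (g x hx) := ⟨by
      apply pushout.hom_ext
      · refine latchingObj_hom_ext fun y hy => ?_
        have h2 := (a ⟨y, hmem hy⟩ hy).2.2
        dsimp at h2
        rw [pushout.inl_desc_assoc, ← Category.assoc, latchingι_latchingDesc, Category.assoc,
          p.naturality, reassoc_of% h2, reassoc_of% @inl_relativeLatchingMap,
          reassoc_of% @latchingι_latchingMap, hg _ _ (hmem hy)]
      · rw [pushout.inr_desc_assoc, reassoc_of% @inr_relativeLatchingMap, w]⟩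
    have := hlift x hx
    refine ⟨⟨sq.lift, ?_, sq.fac_right⟩, fun y hy => ?_⟩
    · rw [← inr_relativeLatchingMap, Category.assoc, sq.fac_left, pushout.inr_desc]
    · have : latchingMap B x ≫ sq.lift = d := by
        rw [← inl_relativeLatchingMap i, Category.assoc, sq.fac_left, pushout.inl_desc]
      dsimp
      rw [← latchingι_latchingMap B hy, Category.assoc, this, latchingι_latchingDesc])
  refine ⟨fun y hy => (a ⟨y, hy⟩).1, fun y hy => (a ⟨y, hy⟩).2, fun y x hy hx h => ?_⟩
  rcases h.eq_or_lt with rfl | h'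
  · simp
  · exact ha ⟨y, hy⟩ ⟨x, hx⟩ h'

theorem hasLiftingProperty_of_relativeLatchingMap {A B X Y : D ⥤ C} (i : A ⟶ B) (p : X ⟶ Y)
    (hlift : ∀ x, HasLiftingProperty (relativeLatchingMap i x) (p.app x)) :
    HasLiftingProperty i p := ⟨fun {f g} sq => by
  obtain ⟨l, hl, hnat⟩ := exists_lift_on_lowerSet (isLowerSet_univ (α := D)) i p
    (fun y _ => f.app y) (fun y _ => g.app y) (fun _ _ _ _ _ => f.naturality _)
    (fun _ _ _ _ _ => g.naturality _) (fun y _ => NatTrans.congr_app sq.w y)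
    (fun x _ => hlift x)
  exact CommSq.HasLift.mk'
    { l :=
        { app := fun y => l y trivial
          naturality := fun y x h => hnat y x trivial trivial (leOfHom h) }
      fac_left := by ext y; exact (hl y trivial).1
      fac_right := by ext y; exact (hl y trivial).2 }⟩

theorem hasLiftingProperty_latchingObjMap {A B : D ⥤ C} (i : A ⟶ B) {E F : C} (p : E ⟶ F)
    (x : D) (hlift : ∀ y < x, HasLiftingProperty (relativeLatchingMap i y) p) :
    HasLiftingProperty (latchingObjMap i x) p := ⟨fun {f g} sq => by
  have hcomp (A : D ⥤ C) {Z : C} (k : latchingObj A x ⟶ Z) (y z : D) (hy : y < x) (hz : z < x)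
      (h : y ≤ z) : A.map (homOfLE h) ≫ latchingι A hz ≫ k = latchingι A hy ≫ k := by
    rcases h.eq_or_lt with rfl | h'
    · simp
    · rw [reassoc_of% (map_latchingι A h' hz)]
  obtain ⟨l, hl, hnat⟩ : ∃ l : ∀ y, y < x → (B.obj y ⟶ E),
      (∀ y (hy : y < x), i.app y ≫ l y hy = latchingι A hy ≫ f ∧
        l y hy ≫ p = latchingι B hy ≫ g) ∧
      ∀ (y z : D) (hy : y < x) (hz : z < x) (h : y ≤ z),
        B.map (homOfLE h) ≫ l z hz = l y hy ≫ 𝟙 E :=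
    exists_lift_on_lowerSet (isLowerSet_Iio x) i
      ((Functor.const D).map p) (fun y hy => latchingι A hy ≫ f) (fun y hy => latchingι B hy ≫ g)
      (fun y z hy hz h => (hcomp A f y z hy hz h).trans (Category.comp_id _).symm)
      (fun y z hy hz h => (hcomp B g y z hy hz h).trans (Category.comp_id _).symm)
      (fun y (hy : y < x) => show (latchingι A hy ≫ f) ≫ p = i.app y ≫ latchingι B hy ≫ g by
        rw [Category.assoc, sq.w, reassoc_of% @latchingι_latchingObjMap])
      hlift
  exact CommSq.HasLift.mk'
    { l := latchingDesc l fun z y hzy hy => by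
        simpa using hnat z y (hzy.trans hy) hy hzy.le
      fac_left := latchingObj_hom_ext fun y hy => by
        rw [reassoc_of% @latchingι_latchingObjMap, latchingι_latchingDesc]
        exact (hl y hy).1
      fac_right := latchingObj_hom_ext fun y hy => by
        rw [← Category.assoc, latchingι_latchingDesc]
        exact (hl y hy).2 }⟩

variable (D) in
/-- The natural transformations all of whose mediating morphisms belong to `L`. -/
def latchingProperty (L : MorphismProperty C) : MorphismProperty (D ⥤ C) :=
  fun _ _ φ => ∀ x : D, L (relativeLatchingMap φ x)

instance (L : MorphismProperty C) [L.IsStableUnderRetracts] :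
    (latchingProperty D L).IsStableUnderRetracts where
  of_retract h hg x := L.of_retract (retractArrowRelativeLatchingMap h x) (hg x)

/-- The map `X(x) ⟶ pushout` lies in `L` if the mediating morphisms below `x` do. -/
theorem inr_mem_of_latchingProperty (L R : MorphismProperty C)
    [MorphismProperty.IsWeakFactorizationSystem L R] {A B : D ⥤ C} (i : A ⟶ B) (x : D)
    (hi : ∀ y < x, L (relativeLatchingMap i y)) :
    L (pushout.inr (latchingObjMap i x) (latchingMap A x)) := by
  have h : L (latchingObjMap i x) := by
    rw [← MorphismProperty.llp_eq_of_wfs L R]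
    intro E F p hp
    exact hasLiftingProperty_latchingObjMap i p x fun y hy =>
      MorphismProperty.hasLiftingProperty_of_wfs _ _ (hi y hy) hp
  have : L.IsStableUnderCobaseChange := by
    rw [← MorphismProperty.llp_eq_of_wfs L R]
    infer_instance
  exact L.of_isPushout (IsPushout.of_hasPushout _ _).flip h

end Lifting

section Replacement

variable {D : Type w} [PartialOrder D] {C : Type u} [Category.{v} C] [HasFiniteColimits C]
  [Finite D]

/-- The objects of the functor obtained from `W` by replacing its value at `m` with `V`. -/
def replaceObj (W : D ⥤ C) {m : D} (V : C) {x : D} : Decidable (x = m) → C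
  | isTrue _ => V
  | isFalse _ => W.obj x

variable {W : D ⥤ C} {m : D} {V : C}

/-- The morphisms of the functor obtained from `W` by replacing its value at `m` with `V`. -/
noncomputable def replaceMap (a : latchingObj W m ⟶ V) (b : V ⟶ W.obj m) {x y : D} (h : x ≤ y) :
    ∀ (dx : Decidable (x = m)) (dy : Decidable (y = m)), replaceObj W V dx ⟶ replaceObj W V dy
  | isTrue _, isTrue _ => 𝟙 V
  | isFalse hx, isTrue hy => latchingι W (lt_of_le_of_ne (h.trans_eq hy) hx) ≫ a
  | isTrue hx, isFalse _ => b ≫ W.map (homOfLE (hx.symm.trans_le h))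
  | isFalse _, isFalse _ => W.map (homOfLE h)

/-- The functor obtained from `W` by replacing its value at `m` with an object `V` through which
the latching map of `W` at `m` factors. -/
noncomputable def replaceFunctor (dec : ∀ x, Decidable (x = m)) (a : latchingObj W m ⟶ V)
    (b : V ⟶ W.obj m) (hab : a ≫ b = latchingMap W m) : D ⥤ C where
  obj x := replaceObj W V (dec x)
  map f := replaceMap a b (leOfHom f) (dec _) (dec _)
  map_id x := by
    generalize dec x = d
    cases d
    · exact W.map_id x
    · rfl
  map_comp {x y z} f g := by
    generalize dec x = dx
    generalize dec y = dy
    generalize dec z = dz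
    have hxy := leOfHom f
    have hyz := leOfHom g
    rcases dx with hx | hx <;> rcases dy with hy | hy <;> rcases dz with hz | hz <;>
      dsimp only [replaceMap, replaceObj]
    · rw [← W.map_comp]; rfl
    · rcases hxy.eq_or_lt with rfl | h
      · simp
      · rw [reassoc_of% map_latchingι W h]
    · rw [Category.assoc, reassoc_of% hab, reassoc_of% @latchingι_latchingMap, ← W.map_comp]; rfl
    · simp
    · rw [Category.assoc, ← W.map_comp]; rfl
    · subst hx
      exact absurd (le_antisymm (hyz.trans_eq hz) hxy) hy
    · simp
    · simp

theorem exists_replacement {X W : D ⥤ C} (c : X ⟶ W) (m : D) {V : C}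
    (u : relativeLatchingObj c m ⟶ V) (v : V ⟶ W.obj m) (huv : u ≫ v = relativeLatchingMap c m) :
    ∃ (W' : D ⥤ C) (c' : X ⟶ W') (π : W' ⟶ W) (h : c' ≫ π = 𝟙 X ≫ c) (e : V ≅ W'.obj m),
      (∀ x, x ≠ m → IsIso (π.app x)) ∧ e.hom ≫ π.app m = v ∧
        relativeLatchingMap c' m = relativeLatchingObjMap (𝟙 X) π h m ≫ u ≫ e.hom := by
  let dec : ∀ x, Decidable (x = m) := fun x => Classical.propDecidable _
  let a : latchingObj W m ⟶ V := pushout.inl _ _ ≫ u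
  have hab : a ≫ v = latchingMap W m := by simp [a, huv]
  have huv' : pushout.inr _ _ ≫ u ≫ v = c.app m := by rw [huv, inr_relativeLatchingMap]
  let c₀ : ∀ {x : D} (d : Decidable (x = m)), X.obj x ⟶ replaceObj W V d := fun {x} d =>
    match d with
    | isTrue hx => X.map (homOfLE hx.le) ≫ pushout.inr _ _ ≫ u
    | isFalse _ => c.app x
  let π₀ : ∀ {x : D} (d : Decidable (x = m)), replaceObj W V d ⟶ W.obj x := fun {x} d =>
    match d with
    | isTrue hx => v ≫ W.map (homOfLE hx.ge)
    | isFalse _ => 𝟙 (W.obj x)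
  let e₀ : ∀ (d : Decidable (m = m)), V ≅ replaceObj W V d := fun d =>
    match d with
    | isTrue _ => Iso.refl V
    | isFalse h => (h rfl).elim
  let W' := replaceFunctor dec a v hab
  let c' : X ⟶ W' :=
    { app := fun x => c₀ (dec x)
      naturality := fun x y f => by
        change X.map f ≫ c₀ (dec y) =
          c₀ (dec x) ≫ replaceMap a v (leOfHom f) (dec x) (dec y)
        generalize dec x = dx
        generalize dec y = dy
        rcases dx with hx | hx <;> rcases dy with hy | hy <;> dsimp only [replaceMap, replaceObj, c₀]
        · exact c.naturality f
        · have h : x < m := lt_of_le_of_ne ((leOfHom f).trans_eq hy) hx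
          rw [← reassoc_of% latchingι_latchingObjMap c h]
          dsimp only [a]
          rw [pushout.condition_assoc, reassoc_of% latchingι_latchingMap X h, ← X.map_comp_assoc]
          rfl
        · simp only [Category.assoc]
          rw [reassoc_of% huv', ← c.naturality, ← X.map_comp_assoc]
          rfl
        · rw [← X.map_comp_assoc]
          exact (Category.comp_id _).symm }
  let π : W' ⟶ W :=
    { app := fun x => π₀ (dec x)
      naturality := fun x y f => by
        change replaceMap a v (leOfHom f) (dec x) (dec y) ≫ π₀ (dec y) =
          π₀ (dec x) ≫ W.map f
        generalize dec x = dx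
        generalize dec y = dy
        rcases dx with hx | hx <;> rcases dy with hy | hy <;> dsimp only [replaceMap, replaceObj, π₀]
        · exact (Category.comp_id _).trans (Category.id_comp _).symm
        · rw [Category.assoc, reassoc_of% hab, reassoc_of% @latchingι_latchingMap, ← W.map_comp]
          exact (Category.id_comp _).symm
        · rw [Category.comp_id, Category.assoc, ← W.map_comp]
          rfl
        · rw [Category.assoc, ← W.map_comp]
          exact Category.id_comp _ }
  have h : c' ≫ π = 𝟙 X ≫ c := by
    rw [Category.id_comp]
    ext x
    change c₀ (dec x) ≫ π₀ (dec x) = _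
    generalize dec x = dx
    rcases dx with hx | hx <;> dsimp only [replaceObj, c₀, π₀]
    · exact Category.comp_id _
    · subst hx
      simp only [Category.assoc]
      rw [reassoc_of% huv']
      simp
  refine ⟨W', c', π, h, e₀ (dec m), fun x hx => ?_, ?_, ?_⟩
  · change IsIso (π₀ (dec x))
    generalize dec x = dx
    rcases dx with h | h <;> dsimp only [π₀]
    · exact inferInstanceAs (IsIso (𝟙 (W.obj x)))
    · exact absurd h hx
  · change (e₀ (dec m)).hom ≫ π₀ (dec m) = v
    generalize dec m = d
    rcases d with h | h <;> dsimp only [replaceObj, π₀, e₀, Iso.refl_hom]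
    · exact (h rfl).elim
    · simp
  · apply pushout.hom_ext
    · rw [inl_relativeLatchingMap, reassoc_of% @inl_relativeLatchingObjMap]
      refine latchingObj_hom_ext fun y hy => ?_
      rw [latchingι_latchingMap, reassoc_of% @latchingι_latchingObjMap]
      change replaceMap a v hy.le (dec y)
        (dec m) = π₀ (dec y) ≫ latchingι W hy ≫ pushout.inl _ _ ≫ u ≫ (e₀ (dec m)).hom
      generalize dec y = dy
      generalize dec m = d
      rcases dy with h' | h'
      · rcases d with h | h
        · exact (h rfl).elim
        · dsimp only [replaceObj, π₀, e₀, replaceMap, Iso.refl_hom]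
          refine Eq.trans ?_ (Category.id_comp _).symm
          exact congrArg (latchingι W hy ≫ pushout.inl _ _ ≫ ·) (Category.comp_id u).symm
      · exact absurd h' hy.ne
    · rw [inr_relativeLatchingMap, reassoc_of% @inr_relativeLatchingObjMap, NatTrans.id_app,
        Category.id_comp]
      change c₀ (dec m) = pushout.inr _ _ ≫ u ≫ (e₀ (dec m)).hom
      generalize dec m = d
      rcases d with h | h
      · exact (h rfl).elim
      · dsimp only [replaceObj, c₀, e₀, Iso.refl_hom]
        rw [Category.comp_id]
        exact (congrArg (· ≫ _) (X.map_id m)).trans (Category.id_comp _)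

/-- Factorizations in `D ⥤ C` whose mediating morphisms belong to a prescribed
isomorphism-invariant class `Q` of factorizations in `C`. -/
theorem exists_latching_factorization
    (Q : ∀ ⦃A B Z : C⦄, (A ⟶ B) → (B ⟶ Z) → Prop)
    (hiso : ∀ ⦃A A' B B' Z Z' : C⦄ (c : A ⟶ B) (p : B ⟶ Z) (c' : A' ⟶ B') (p' : B' ⟶ Z')
      (e : A ⟶ A') (g : B ⟶ B') (k : Z ⟶ Z') [IsIso e] [IsIso g] [IsIso k],
      c ≫ g = e ≫ c' → p ≫ k = g ≫ p' → Q c p → Q c' p')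
    (hQ : ∀ ⦃A Z : C⦄ (f : A ⟶ Z), ∃ (B : C) (c : A ⟶ B) (p : B ⟶ Z), c ≫ p = f ∧ Q c p)
    {X Y : D ⥤ C} (f : X ⟶ Y) :
    ∃ (W : D ⥤ C) (c : X ⟶ W) (p : W ⟶ Y), c ≫ p = f ∧
      ∀ x, Q (relativeLatchingMap c x) (p.app x) := by
  suffices h : ∃ (W : D ⥤ C) (c : X ⟶ W) (p : W ⟶ Y), c ≫ p = f ∧
      (∀ x ∈ Set.univ, Q (relativeLatchingMap c x) (p.app x)) ∧
      ∀ x ∉ Set.univ, IsIso (p.app x) by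
    obtain ⟨W, c, p, h, hc, -⟩ := h
    exact ⟨W, c, p, h, fun x => hc x trivial⟩
  refine lowerSet_induction (P := fun S => ∃ (W : D ⥤ C) (c : X ⟶ W) (p : W ⟶ Y), c ≫ p = f ∧
      (∀ x ∈ S, Q (relativeLatchingMap c x) (p.app x)) ∧ ∀ x ∉ S, IsIso (p.app x))
    ⟨Y, f, 𝟙 Y, Category.comp_id f, fun x hx => hx.elim, fun x _ => inferInstance⟩ ?_
  rintro S m hS hm - ⟨W, c, p, hcp, hSQ, hSiso⟩
  obtain ⟨V, s, t, hst, hQst⟩ := hQ (relativeLatchingMap c m)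
  obtain ⟨W', c', π, h, e, hπ, heπ, hc'⟩ := exists_replacement c m s t hst
  refine ⟨W', c', π ≫ p, by rw [reassoc_of% h, hcp], ?_, ?_⟩
  · rintro x (rfl | hx)
    · have := isIso_relativeLatchingObjMap (𝟙 X) π h x (fun _ _ => inferInstance)
        (fun y hy => hπ y hy.ne)
      have := hSiso x hm
      refine hiso s t _ _ (inv (relativeLatchingObjMap (𝟙 X) π h x)) e.hom (p.app x) ?_ ?_ hQst
      · rw [hc', IsIso.inv_hom_id_assoc]
      · rw [NatTrans.comp_app, reassoc_of% heπ]
    · have hne : ∀ y ≤ x, y ≠ m := fun y hy hym => hm (hym ▸ hS hy hx)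
      have := isIso_relativeLatchingObjMap (𝟙 X) π h x (fun _ _ => inferInstance)
        (fun y hy => hπ y (hne y hy.le))
      have := hπ x (hne x le_rfl)
      refine hiso _ _ _ _ (inv (relativeLatchingObjMap (𝟙 X) π h x)) (inv (π.app x)) (𝟙 _)
        ?_ ?_ (hSQ x hx)
      · rw [IsIso.eq_inv_comp, ← Category.assoc, IsIso.comp_inv_eq]
        exact relativeLatchingObjMap_relativeLatchingMap _ _ _ _
      · simp
  · intro x hx
    have := hSiso x fun h => hx (Or.inr h)
    have := hπ x fun h => hx (Or.inl h)
    rw [NatTrans.comp_app]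
    infer_instance

end Replacement

section Minimal

variable {C : Type u} [Category.{v} C]

theorem IsMinimalFactorization.of_isIso {A A' B B' Z Z' : C} {c : A ⟶ B} {p : B ⟶ Z}
    (h : IsMinimalFactorization c p) (c' : A' ⟶ B') (p' : B' ⟶ Z') (e : A ⟶ A') (g : B ⟶ B')
    (k : Z ⟶ Z') [IsIso e] [IsIso g] [IsIso k] (hc : c ≫ g = e ≫ c') (hp : p ≫ k = g ≫ p') :
    IsMinimalFactorization c' p' := by
  intro φ hφc hφp
  have : IsIso (g ≫ φ ≫ inv g) := h _
    (by rw [reassoc_of% hc, reassoc_of% hφc, ← reassoc_of% hc, IsIso.hom_inv_id,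
      Category.comp_id])
    (by
      have hp' : inv g ≫ p = p' ≫ inv k := by
        rw [IsIso.eq_comp_inv, Category.assoc, hp, IsIso.inv_hom_id_assoc]
      rw [Category.assoc, Category.assoc, hp', reassoc_of% hφp, ← hp',
        IsIso.hom_inv_id_assoc])
  have : IsIso (φ ≫ inv g) := IsIso.of_isIso_comp_left g _
  exact IsIso.of_isIso_comp_right φ (inv g)

/-- An endomorphism of a minimal factorization which covers an automorphism of the source is an
isomorphism, provided that the factors have the lifting property. -/
theorem IsMinimalFactorization.isIso_of_comm {A B Z : C} {c : A ⟶ B} {p : B ⟶ Z}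
    (h : IsMinimalFactorization c p) [HasLiftingProperty c p] (φ : B ⟶ B) (a : A ⟶ A) [IsIso a]
    (hc : c ≫ φ = a ≫ c) (hp : φ ≫ p = p) : IsIso φ := by
  have sq : CommSq (inv a ≫ c) c p p := ⟨by
    rw [Category.assoc, IsIso.inv_comp_eq, ← reassoc_of% hc, hp]⟩
  have h₁ : IsIso (φ ≫ sq.lift) := h _
    (by rw [reassoc_of% hc, sq.fac_left, IsIso.hom_inv_id_assoc])
    (by rw [Category.assoc, sq.fac_right, hp])
  have h₂ : IsIso (sq.lift ≫ φ) := h _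
    (by rw [reassoc_of% sq.fac_left, hc, IsIso.inv_hom_id_assoc])
    (by rw [Category.assoc, hp, sq.fac_right])
  have : IsSplitMono φ := IsSplitMono.mk' ⟨sq.lift ≫ inv (φ ≫ sq.lift), by
    rw [← Category.assoc, IsIso.hom_inv_id]⟩
  have : IsSplitEpi φ := IsSplitEpi.mk' ⟨inv (sq.lift ≫ φ) ≫ sq.lift, by
    rw [Category.assoc, IsIso.inv_hom_id]⟩
  exact isIso_of_mono_of_isSplitEpi φ

variable {D : Type w} [PartialOrder D] [HasFiniteColimits C] [Finite D]

theorem isMinimalFactorization_of_relativeLatchingMap {X W Y : D ⥤ C} (c : X ⟶ W) (p : W ⟶ Y)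
    (hlift : ∀ x, HasLiftingProperty (relativeLatchingMap c x) (p.app x))
    (hmin : ∀ x, IsMinimalFactorization (relativeLatchingMap c x) (p.app x)) :
    IsMinimalFactorization c p := by
  intro φ hc hp
  rw [NatTrans.isIso_iff_isIso_app]
  intro x
  induction x using (wellFounded_lt (α := D)).induction with
  | _ x ih =>
    have h : c ≫ φ = 𝟙 X ≫ c := hc.trans (Category.id_comp c).symm
    have := isIso_relativeLatchingObjMap (𝟙 X) φ h x (fun _ _ => inferInstance) ih
    have := hlift x
    exact (hmin x).isIso_of_comm _ (relativeLatchingObjMap (𝟙 X) φ h x)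
      (relativeLatchingObjMap_relativeLatchingMap _ _ _ _).symm (NatTrans.congr_app hp x)

end Minimal

section WeakFactorizationSystem

variable {D : Type w} [PartialOrder D] {C : Type u} [Category.{v} C] [HasFiniteColimits C]
  [Finite D]

variable (D) in
/-- A weak factorization system on `C` induces one on `D ⥤ C`, whose right class is defined
objectwise and whose left class is defined by mediating morphisms. -/
theorem isWeakFactorizationSystem_latchingProperty (L R : MorphismProperty C)
    [L.IsStableUnderRetracts] [R.IsStableUnderRetracts]
    [MorphismProperty.IsWeakFactorizationSystem L R] :
    MorphismProperty.IsWeakFactorizationSystem (latchingProperty D L) (R.functorCategory D) := by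
  have : MorphismProperty.HasFactorization (latchingProperty D L) (R.functorCategory D) := ⟨by
    intro X Y f
    obtain ⟨W, c, p, h, hcp⟩ := exists_latching_factorization (fun _ _ _ c p => L c ∧ R p)
      (fun A A' B B' Z Z' c p c' p' e g k _ _ _ hc hp ⟨hL, hR⟩ =>
        ⟨(L.arrow_mk_iso_iff (Arrow.isoMk (asIso e) (asIso g) hc.symm)).1 hL,
          (R.arrow_mk_iso_iff (Arrow.isoMk (asIso g) (asIso k) hp.symm)).1 hR⟩)
      (fun A Z f => by
        have d := MorphismProperty.factorizationData L R f
        exact ⟨d.Z, d.i, d.p, d.fac, d.hi, d.hp⟩) f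
    exact ⟨⟨W, c, p, h, fun x => (hcp x).1, fun x => (hcp x).2⟩⟩⟩
  exact MorphismProperty.IsWeakFactorizationSystem.mk' _ _ fun i p hi hp =>
    hasLiftingProperty_of_relativeLatchingMap i p fun x =>
      MorphismProperty.hasLiftingProperty_of_wfs _ _ (hi x) (hp x)

end WeakFactorizationSystem

section ModelStructure

variable {D : Type w} [PartialOrder D] [Finite D] {C : Type u} [Category.{v} C] [ModelCategory C]

/-- A transformation has trivial cofibrations as mediating morphisms if and only if its mediating
morphisms are cofibrations and it is an objectwise weak equivalence. -/
theorem latchingProperty_trivialCofibrations_iff {A B : D ⥤ C} (i : A ⟶ B) :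
    latchingProperty D (trivialCofibrations C) i ↔
      latchingCofibrations D C i ∧ objectwiseWeakEquivalences D C i := by
  have hinr (x : D) (hi : ∀ y < x, trivialCofibrations C (relativeLatchingMap i y)) :
      WeakEquivalence (pushout.inr (latchingObjMap i x) (latchingMap A x)) :=
    ((mem_trivialCofibrations_iff _).1
      (inr_mem_of_latchingProperty (trivialCofibrations C) (fibrations C) i x hi)).2
  constructor
  · intro h
    refine ⟨fun x => ((mem_trivialCofibrations_iff _).1 (h x)).1, fun x => ?_⟩
    have := hinr x fun y _ => h y
    have := ((mem_trivialCofibrations_iff _).1 (h x)).2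
    rw [← inr_relativeLatchingMap]
    infer_instance
  · rintro ⟨hc, hw⟩ x
    induction x using (wellFounded_lt (α := D)).induction with
    | _ x ih =>
      have := hinr x ih
      have := hw x
      exact (mem_trivialCofibrations_iff _).2
        ⟨hc x, weakEquivalence_of_precomp_of_fac (inr_relativeLatchingMap i x)⟩

instance : (objectwiseWeakEquivalences D C).HasTwoOutOfThreeProperty where
  comp_mem f g hf hg x := by
    have := hf x
    have := hg x
    rw [NatTrans.comp_app]
    infer_instance
  of_postcomp f g hg hfg x := by
    have := hg x
    have := hfg x
    exact weakEquivalence_of_postcomp_of_fac (NatTrans.comp_app f g x).symm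
  of_precomp f g hf hfg x := by
    have := hf x
    have := hfg x
    exact weakEquivalence_of_precomp_of_fac (NatTrans.comp_app f g x).symm

variable (D C) in
/-- The model structure on `D ⥤ C` for a finite poset `D`. -/
@[reducible]
noncomputable def modelCategoryFunctor : ModelCategory (D ⥤ C) :=
  letI : CategoryWithFibrations (D ⥤ C) := ⟨objectwiseFibrations D C⟩
  letI : CategoryWithCofibrations (D ⥤ C) := ⟨latchingCofibrations D C⟩
  letI : CategoryWithWeakEquivalences (D ⥤ C) := ⟨objectwiseWeakEquivalences D C⟩
  haveI : (weakEquivalences (D ⥤ C)).HasTwoOutOfThreeProperty :=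
    inferInstanceAs (objectwiseWeakEquivalences D C).HasTwoOutOfThreeProperty
  haveI : MorphismProperty.IsWeakFactorizationSystem (cofibrations (D ⥤ C))
      (trivialFibrations (D ⥤ C)) := by
    convert isWeakFactorizationSystem_latchingProperty D (cofibrations C) (trivialFibrations C)
      using 1
    · ext X Y f
      exact forall_congr' fun x => cofibration_iff _
    · ext X Y f
      exact forall_and.symm.trans (forall_congr' fun x => (mem_trivialFibrations_iff _).symm)
  haveI : MorphismProperty.IsWeakFactorizationSystem (trivialCofibrations (D ⥤ C))
      (fibrations (D ⥤ C)) := by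
    convert isWeakFactorizationSystem_latchingProperty D (trivialCofibrations C) (fibrations C)
      using 1
    · ext X Y f
      exact (latchingProperty_trivialCofibrations_iff f).symm
    · ext X Y f
      exact forall_congr' fun x => fibration_iff _
  ModelCategory.mk' (D ⥤ C)

theorem minimalCofibrantFactorizationAxiom_functor (h : MinimalCofibrantFactorizationAxiom C) :
    @MinimalCofibrantFactorizationAxiom (D ⥤ C) _ (modelCategoryFunctor D C) := by
  let := modelCategoryFunctor D C
  intro X Y f
  obtain ⟨W, c, p, hf, hcp⟩ := exists_latching_factorization
    (fun _ _ _ c p => cofibrations C c ∧ trivialFibrations C p ∧ IsMinimalFactorization c p)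
    (fun A A' B B' Z Z' c p c' p' e g k _ _ _ hc hp ⟨hL, hR, hm⟩ =>
      ⟨((cofibrations C).arrow_mk_iso_iff (Arrow.isoMk (asIso e) (asIso g) hc.symm)).1 hL,
        ((trivialFibrations C).arrow_mk_iso_iff (Arrow.isoMk (asIso g) (asIso k) hp.symm)).1 hR,
        hm.of_isIso c' p' e g k hc hp⟩)
    (fun A Z f => by
      obtain ⟨B, c, p, hf, hc, hp, hw, hm⟩ := h f
      exact ⟨B, c, p, hf, mem_cofibrations c, mem_trivialFibrations p, hm⟩) f
  refine ⟨W, c, p, hf, ⟨fun x => (cofibration_iff _).2 (hcp x).1⟩,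
    ⟨fun x => ((mem_trivialFibrations_iff _).1 (hcp x).2.1).1⟩,
    ⟨fun x => ((mem_trivialFibrations_iff _).1 (hcp x).2.1).2⟩,
    isMinimalFactorization_of_relativeLatchingMap c p (fun x =>
      MorphismProperty.hasLiftingProperty_of_wfs _ _ (hcp x).1 (hcp x).2.1)
      fun x => (hcp x).2.2⟩

end ModelStructure

end FinitePosetModel

theorem mainTheorem11 (D : Type w) [PartialOrder D] [Finite D]
    (C : Type u) [Category.{v} C] [ModelCategory C] :
    ∃ M : ModelCategory (D ⥤ C),
      M.categoryWithWeakEquivalences.weakEquivalences =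
        FinitePosetModel.objectwiseWeakEquivalences D C ∧
      M.categoryWithFibrations.fibrations = FinitePosetModel.objectwiseFibrations D C ∧
      M.categoryWithCofibrations.cofibrations = FinitePosetModel.latchingCofibrations D C ∧
      (FinitePosetModel.MinimalCofibrantFactorizationAxiom C →
        @FinitePosetModel.MinimalCofibrantFactorizationAxiom (D ⥤ C) _ M) :=
  ⟨FinitePosetModel.modelCategoryFunctor D C, rfl, rfl, rfl,
    FinitePosetModel.minimalCofibrantFactorizationAxiom_functor⟩
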